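/- **Conventions.** A graph $X$ is a finite graph in the sense of Serre: finite sets $V_X$ of vertices and $\mathbf{E}_X$ of directed edges, maps $o,t:\mathbf{E}_X\to V_X$ and an inversion $e\mapsto\bar e$ with $\bar e\ne e$, $\bar{\bar e}=e$, $o(\bar e)=t(e)$, $t(\bar e)=o(e)$ (loops and parallel edges are allowed). Its Euler characteristic is $\chi(X)=\operatorname{rank}H_0(X,\mathbb{Z})-\operatorname{rank}H_1(X,\mathbb{Z})$. Connected graphs are non-empty. A cover $p:Y\to X$ is a morphism of graphs that is surjective on vertices and maps, for every vertex $w$ of $Y$, the directed edges with origin $w$ bijectively onto those with origin $p(w)$. It is Galois if $Y$ is connected and the group $\mathrm{Gal}(Y/X)=\{\sigma\in\mathrm{Aut}(Y): p\circ\sigma=p\}$ acts transitively on every fibre $p^{-1}(v)$, $v\in V_X$. The degree $[Y:X]$ is the common cardinality of the fibres $p^{-1}(v)$. An orientation of $X$ is a set $S\subseteq\mathbf{E}_X$ containing exactly one of $e,\bar e$ for every $e\in \mathbf{E}_X$; $S_Y=p^{-1}(S)$ is then an orientation of $Y$. Let $\ell$ be a prime and $\alpha:S\to\mathbb{Z}_\ell$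 a function. For $n\ge 0$ let $\alpha_{/n}:S\to\mathbb{Z}/\ell^n\mathbb{Z}$ be its reduction, extended to $\mathbf{E}_X$ by $\alpha_{/n}(\bar s)=-\alpha_{/n}(s)$, and let $X(\mathbb{Z}/\ell^n\mathbb{Z},S,\alpha_{/n})$ be the graph with vertices $V_X\times\mathbb{Z}/\ell^n\mathbb{Z}$ and directed edges $\mathbf{E}_X\times\mathbb{Z}/\ell^n\mathbb{Z}$, where $(e,\sigma)$ goes from $(o(e),\sigma)$ to $(t(e),\sigma+\alpha_{/n}(e))$ and $\overline{(e,\sigma)}=(\bar e,\sigma+\alpha_{/n}(e))$. Define $$f_{X,\alpha}(T)=\det(D-A_\rho)\in\mathbb{Z}_\ell[[T]],$$ where $D$ is the diagonal matrix indexed by $V_X$ with entries $|\{e\in \mathbf{E}_X: o(e)=v\}|$, and $$(A_\rho)_{v,w}=\sum_{\substack{s\in S\\ o(s)=v,\ t(s)=w}}(1+T)^{\alpha(s)}+\sum_{\substack{s\in S\\ o(s)=w,\ t(s)=v}}(1+T)^{-\alpha(s)} .$$ For $Q=\sum_i a_iT^i\in\mathbb{Z}_\ell[[T]]$ put $\mu(Q)=\min_i\operatorname{ord}_\ell(a_i)$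 (which is $\infty$ for $Q=0$) and $\lambda(Q)=\min\{i:\operatorname{ord}_\ell(a_i)=\mu(Q)\}$. The Iwasawa invariants are $\mu(X,\alpha)=\mu(f_{X,\alpha})$ and $\lambda(X,\alpha)=\lambda(f_{X,\alpha})-1$. **Theorem.** Let $\ell$ be a prime, $X$ a connected graph with $\chi(X)\neq 0$, $S$ an orientation of $X$, and $\alpha:S\to\mathbb{Z}_\ell$ a function. Let $p:Y\to X$ be a Galois cover whose group $\mathrm{Gal}(Y/X)$ is an $\ell$-group. Assume that the graphs $Y(\mathbb{Z}/\ell^n\mathbb{Z},S_Y,(\alpha\circ p)_{/n})$ are connected for all $n\ge 0$. Then the graphs $X(\mathbb{Z}/\ell^n\mathbb{Z},S,\alpha_{/n})$ are connected for all $n\ge 0$, all fibres of $p$ over vertices of $X$ have the same cardinality $[Y:X]$, and $$\mu(X,\alpha)=0\iff\mu(Y,\alpha\circ p)=0,$$ in which case $$\lambda(Y,\alpha\circ p)+1=[Y:X]\cdot(\lambda(X,\alpha)+1).$$ -/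

import Mathlib

/-- A graph in the sense of Serre, with vertex set `V` and set of directed edges `E`: origin and
terminus maps, and a fixed-point-free inversion. Loops and parallel edges are allowed. -/
structure SerreGraph (V E : Type*) where
  o : E → V
  t : E → V
  inv : E → E
  inv_ne : ∀ e, inv e ≠ e
  inv_inv : ∀ e, inv (inv e) = e
  o_inv : ∀ e, o (inv e) = t e
  t_inv : ∀ e, t (inv e) = o e

namespace SerreGraph

section Basic

variable {V E : Type*} (X : SerreGraph V E)

/-- A graph is connected if it is nonempty and any two vertices are joined by a path. -/
def Connected : Prop :=
  Nonempty V ∧ ∀ v w : V, Relation.ReflTransGen (fun a b => ∃ e, X.o e = a ∧ X.t e = b) v w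

/-- The group of cellular `1`-chains: the free abelian group on the directed edges modulo
`e + ē = 0`, realised (for a finite graph) as the functions `c` with `c ē = - c e`. -/
def oneChains : Submodule ℤ (E → ℤ) where
  carrier := {c | ∀ e, c (X.inv e) = - c e}
  add_mem' := by
    intro a b ha hb e
    simp only [Set.mem_ofPred_eq, Pi.add_apply] at *
    rw [ha e, hb e]
    ring
  zero_mem' := by
    intro e
    simp
  smul_mem' := by
    intro k a ha e
    simp only [Set.mem_ofPred_eq, Pi.smul_apply, smul_eq_mul] at *
    rw [ha e]
    ring

open Classical in
/-- The boundary map, which sends the undirected edge underlying `e` to `t e - o e`: each of the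
two directions of an undirected edge contributes its own coefficient at its terminus. -/
noncomputable def boundary [Fintype E] : X.oneChains →ₗ[ℤ] (V → ℤ) where
  toFun c := fun v => ∑ e : E with X.t e = v, (c : E → ℤ) e
  map_add' := by
    intro a b
    funext v
    simp [Finset.sum_add_distrib]
  map_smul' := by
    intro k a
    funext v
    simp [Finset.mul_sum]

/-- `b₀ = rank H₀(X, ℤ)`. -/
noncomputable def b0 [Fintype E] : ℕ :=
  Module.finrank ℤ ((V → ℤ) ⧸ LinearMap.range X.boundary)

/-- `b₁ = rank H₁(X, ℤ)`. -/
noncomputable def b1 [Fintype E] : ℕ :=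
  Module.finrank ℤ (LinearMap.ker X.boundary)

/-- The Euler characteristic `χ = b₀ - b₁`. -/
noncomputable def eulerChar [Fintype E] : ℤ := (X.b0 : ℤ) - (X.b1 : ℤ)

/-- An orientation: a set of directed edges containing exactly one of `e`, `ē` for all `e`. -/
structure Orientation where
  carrier : Set E
  disj : ∀ e, e ∈ carrier → X.inv e ∉ carrier
  cover : ∀ e, e ∈ carrier ∨ X.inv e ∈ carrier

end Basic

section Voltage

variable {V E : Type*} {X : SerreGraph V E} {A : Type*} [AddGroup A]

open Classical in
/-- Extension of a voltage assignment `α : S → A` to all directed edges by `α ē = - α e`. -/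
noncomputable def extend (S : X.Orientation) (α : S.carrier → A) (e : E) : A :=
  if h : e ∈ S.carrier then α ⟨e, h⟩
  else - α ⟨X.inv e, (S.cover e).resolve_left h⟩

theorem extend_inv (S : X.Orientation) (α : S.carrier → A) (e : E) :
    extend S α (X.inv e) = - extend S α e := by
  by_cases h : e ∈ S.carrier
  · have h' : X.inv e ∉ S.carrier := S.disj e h
    simp [extend, h, h', X.inv_inv]
  · have h' : X.inv e ∈ S.carrier := (S.cover e).resolve_left h
    simp [extend, h, h']

/-- The derived graph `X(A, S, α)`: the edge `(e, σ)` goes from `(o e, σ)` to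
`(t e, σ + α e)` and its inverse is `(ē, σ + α e)`. -/
noncomputable def derived (S : X.Orientation) (α : S.carrier → A) :
    SerreGraph (V × A) (E × A) where
  o x := (X.o x.1, x.2)
  t x := (X.t x.1, x.2 + extend S α x.1)
  inv x := (X.inv x.1, x.2 + extend S α x.1)
  inv_ne x h := X.inv_ne x.1 (congrArg Prod.fst h)
  inv_inv x := by
    simp [X.inv_inv, extend_inv]
  o_inv x := by
    simp [X.o_inv]
  t_inv x := by
    simp [X.t_inv, extend_inv]

end Voltage

section Morphisms

variable {V E W F : Type*}

/-- A morphism of graphs `Y → X`. -/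
structure Hom (Y : SerreGraph W F) (X : SerreGraph V E) where
  onV : W → V
  onE : F → E
  map_o : ∀ e, onV (Y.o e) = X.o (onE e)
  map_t : ∀ e, onV (Y.t e) = X.t (onE e)
  map_inv : ∀ e, onE (Y.inv e) = X.inv (onE e)

variable {Y : SerreGraph W F} {X : SerreGraph V E}

/-- A cover: surjective on vertices, and for every vertex `w` of `Y` a bijection from the directed
edges with origin `w` to the directed edges with origin `p w`. -/
def Hom.IsCover (p : Hom Y X) : Prop :=
  Function.Surjective p.onV ∧
    ∀ w : W, Set.BijOn p.onE {e | Y.o e = w} {e | X.o e = p.onV w}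

/-- The group `Aut_p(Y/X)` of automorphisms `σ` of the graph `Y` with `p ∘ σ = p`; an automorphism
is given by its actions on vertices and on directed edges. -/
def Hom.deckGroup (p : Hom Y X) : Subgroup (Equiv.Perm W × Equiv.Perm F) where
  carrier := {σ | (∀ e, σ.1 (Y.o e) = Y.o (σ.2 e)) ∧ (∀ e, σ.1 (Y.t e) = Y.t (σ.2 e)) ∧
    (∀ e, σ.2 (Y.inv e) = Y.inv (σ.2 e)) ∧
    (∀ w, p.onV (σ.1 w) = p.onV w) ∧ (∀ e, p.onE (σ.2 e) = p.onE e)}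
  mul_mem' := by
    rintro a b ⟨a1, a2, a3, a4, a5⟩ ⟨b1, b2, b3, b4, b5⟩
    refine ⟨fun e => ?_, fun e => ?_, fun e => ?_, fun w => ?_, fun e => ?_⟩
    · simp [a1, b1]
    · simp [a2, b2]
    · simp [a3, b3]
    · simp [a4, b4]
    · simp [a5, b5]
  one_mem' := by simp
  inv_mem' := by
    rintro a ⟨a1, a2, a3, a4, a5⟩
    refine ⟨fun e => ?_, fun e => ?_, fun e => ?_, fun w => ?_, fun e => ?_⟩
    · apply a.1.injective
      simp [a1]
    · apply a.1.injective
      simp [a2]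
    · apply a.2.injective
      simp [a3]
    · simpa using (a4 (a.1⁻¹ w)).symm
    · simpa using (a5 (a.2⁻¹ e)).symm

/-- A Galois cover: a cover with `Y` connected such that `Aut_p(Y/X)` acts transitively on the
fibre of every vertex of `X`. -/
def Hom.IsGalois (p : Hom Y X) : Prop :=
  p.IsCover ∧ Y.Connected ∧
    ∀ w w' : W, p.onV w = p.onV w' → ∃ σ ∈ p.deckGroup, σ.1 w = w'

/-- `p` has degree `d`: every vertex of `X` has exactly `d` preimages. -/
def Hom.HasDegree (p : Hom Y X) (d : ℕ) : Prop :=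
  ∀ v : V, Nat.card {w : W // p.onV w = v} = d

/-- The orientation `S_Y = p⁻¹(S)` of `Y`. -/
def Orientation.comap (S : X.Orientation) (p : Hom Y X) : Y.Orientation where
  carrier := p.onE ⁻¹' S.carrier
  disj e he := by
    rw [Set.mem_preimage, p.map_inv]
    exact S.disj _ he
  cover e := by
    rw [Set.mem_preimage, Set.mem_preimage, p.map_inv]
    exact S.cover _

/-- The voltage assignment `α ∘ p : S_Y → A`. -/
def Hom.pullVoltage {A : Type*} (p : Hom Y X) (S : X.Orientation) (α : S.carrier → A) :
    (S.comap p).carrier → A :=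
  fun s => α ⟨p.onE s.1, s.2⟩

end Morphisms

section Iwasawa

variable {V E : Type*} {X : SerreGraph V E} {ℓ : ℕ} [Fact ℓ.Prime]

/-- All the graphs `X(ℤ/ℓⁿℤ, S, α mod ℓⁿ)`, `n ≥ 0`, are connected. -/
def TowerConnected (S : X.Orientation) (α : S.carrier → ℤ_[ℓ]) : Prop :=
  ∀ n : ℕ, (derived S (fun s => PadicInt.toZModPow n (α s))).Connected

open Classical in
/-- The degree matrix minus the matrix `A_ρ`, whose `(i, j)` entry is the sum of `(1 + T) ^ α(s)`
over the `s ∈ S` from `i` to `j` plus the sum of `(1 + T) ^ (-α(s))` over the `s ∈ S` from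
`j` to `i`. -/
noncomputable def charMatrix [Fintype E] (S : X.Orientation) (α : S.carrier → ℤ_[ℓ]) :
    Matrix V V (PowerSeries ℤ_[ℓ]) :=
  Matrix.diagonal (fun v => (Nat.card {e : E // X.o e = v} : PowerSeries ℤ_[ℓ])) -
  Matrix.of (fun i j =>
    (∑ s : S.carrier, if X.o s = i ∧ X.t s = j then PowerSeries.binomialSeries ℤ_[ℓ] (α s) else 0) +
    (∑ s : S.carrier, if X.o s = j ∧ X.t s = i then PowerSeries.binomialSeries ℤ_[ℓ] (-α s) else 0))

open Classical in
/-- The characteristic power series `f_{X,α}(T) = det (D - A_ρ)`. -/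
noncomputable def charSeries [Fintype V] [Fintype E] (S : X.Orientation)
    (α : S.carrier → ℤ_[ℓ]) : PowerSeries ℤ_[ℓ] :=
  (charMatrix S α).det

/-- `μ(Q) = min ord_ℓ(aᵢ)` for `Q = ∑ aᵢ Tⁱ`; it is `⊤` for `Q = 0`. -/
noncomputable def seriesMu (Q : PowerSeries ℤ_[ℓ]) : ℕ∞ :=
  ⨅ i : ℕ, emultiplicity (ℓ : ℤ_[ℓ]) (PowerSeries.coeff i Q)

/-- `λ(Q) = min {i | ord_ℓ(aᵢ) = μ(Q)}`. -/
noncomputable def seriesLambda (Q : PowerSeries ℤ_[ℓ]) : ℕ :=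
  sInf {i : ℕ | emultiplicity (ℓ : ℤ_[ℓ]) (PowerSeries.coeff i Q) = seriesMu Q}

/-- The Iwasawa invariant `μ(X, α)`. -/
noncomputable def iwasawaMu [Fintype V] [Fintype E] (S : X.Orientation)
    (α : S.carrier → ℤ_[ℓ]) : ℕ∞ :=
  seriesMu (charSeries S α)

/-- The Iwasawa invariant `λ(X, α) = λ(f_{X,α}) - 1`. -/
noncomputable def iwasawaLambda [Fintype V] [Fintype E] (S : X.Orientation)
    (α : S.carrier → ℤ_[ℓ]) : ℤ :=
  (seriesLambda (charSeries S α) : ℤ) - 1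

end Iwasawa

end SerreGraph

/-! The characteristic series of `Y` is, modulo `ℓ`, the `|G|`-th power of the one of `X`, where
`G = Gal(Y/X)`. Indeed `G` acts freely on the vertices of `Y` with quotient `V_X`, so after choosing
a vertex over each vertex of `X` the matrix of `Y` becomes `∑ g, M g ⊗ ρ g`, with `ρ` the regular
representation of `G` and `∑ g, M g` the matrix of `X`. Over `𝔽_ℓ` an `ℓ`-group fixes a nonzero
vector in each nonzero representation, so `ρ` can be made simultaneously unitriangular and the
determinant is that of `∑ g, M g`, raised to the power `|G|`
(`det_sum_kronecker_of_isPGroup`, `det_eq_pow_of_free_action`, `map_charSeries_comap`).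

The vanishing of `μ` means that the reduction modulo `ℓ` is nonzero, and `λ` is then the order of
that reduction (`seriesMu_eq_zero_iff`, `seriesLambda_eq_order`); orders are multiplied by `|G|`
under the `|G|`-th power. Connectedness of the tower descends along the surjection of derived
graphs induced by `p`. -/

/-! ### Determinants and representations of `p`-groups in characteristic `p` -/

open scoped Matrix Kronecker in
/-- A finite-dimensional representation over `𝔽_q` of a finite `q`-group is an iterated extension of
trivial ones, so that twisting the summands `M g` by it only raises the determinant to a power. -/
theorem det_sum_kronecker_of_isPGroup {q : ℕ} [Fact q.Prime] {G : Type*} [Group G] [Fintype G]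
    (hG : IsPGroup q G) {R : Type*} [CommRing R] [Algebra (ZMod q) R]
    {m : Type*} [Fintype m] [DecidableEq m] (M : G → Matrix m m R) (n : ℕ) :
    ∀ {ι : Type*} [Fintype ι] [DecidableEq ι] (_ : Fintype.card ι = n)
      (ρ : G →* Matrix ι ι (ZMod q)),
      (∑ g, M g ⊗ₖ (ρ g).map (algebraMap (ZMod q) R)).det = (∑ g, M g).det ^ n := by
  induction n with
  | zero =>
    intro ι _ _ hι ρ
    have : IsEmpty ι := Fintype.card_eq_zero_iff.mp hι
    rw [Matrix.det_isEmpty, pow_zero]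
  | succ n ih =>
    intro ι _ _ hι ρ
    -- counting fixed points modulo `q` gives a nonzero fixed vector
    obtain ⟨v, hv0, hv⟩ : ∃ v : ι → ZMod q, v ≠ 0 ∧ ∀ g, ρ g *ᵥ v = v := by
      let _ : MulAction G (ι → ZMod q) :=
        { smul := fun g v => ρ g *ᵥ v
          one_smul := fun v => by
            change ρ 1 *ᵥ v = v
            simp
          mul_smul := fun g h v => by
            change ρ (g * h) *ᵥ v = ρ g *ᵥ (ρ h *ᵥ v)
            simp }
      have hdvd : q ∣ Nat.card (ι → ZMod q) := by
        rw [Nat.card_fun, Nat.card_zmod]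
        refine dvd_pow_self q ?_
        rw [Nat.card_eq_fintype_card, hι]
        omega
      have h0 : (0 : ι → ZMod q) ∈ MulAction.fixedPoints G (ι → ZMod q) := fun g =>
        Matrix.mulVec_zero (ρ g)
      obtain ⟨v, hv, hne⟩ :=
        hG.exists_fixed_point_of_prime_dvd_card_of_fixed_point (ι → ZMod q) hdvd h0
      exact ⟨v, hne.symm, hv⟩
    obtain ⟨i, hi⟩ : ∃ i, v i ≠ 0 := Function.ne_iff.mp hv0
    -- a change of basis that makes the fixed vector the `i`-th basis vector
    set P : Matrix ι ι (ZMod q) := (1 : Matrix ι ι (ZMod q)).updateCol i v with hP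
    have hPdet : IsUnit P.det := by
      have : P.det = v i := by
        rw [hP, ← Matrix.cramer_apply, Matrix.cramer_one]
        rfl
      rw [this]
      exact hi.isUnit
    have hPi : P *ᵥ Pi.single i 1 = v := by
      ext j
      simp [hP]
    have hPinv : P⁻¹ *ᵥ v = Pi.single i 1 := by
      rw [← hPi, Matrix.mulVec_mulVec, Matrix.nonsing_inv_mul _ hPdet, Matrix.one_mulVec]
    set σ : G → Matrix ι ι (ZMod q) := fun g => P⁻¹ * ρ g * P with hσ
    have hσcol (g : G) (j : ι) : σ g j i = if j = i then 1 else 0 := by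
      have : σ g *ᵥ Pi.single i 1 = Pi.single i 1 := by
        rw [hσ]
        simp only
        rw [← Matrix.mulVec_mulVec, hPi, ← Matrix.mulVec_mulVec, hv, hPinv]
      have := congrFun this j
      simpa [Pi.single_apply] using this
    have hσ_one : σ 1 = 1 := by simp [hσ, Matrix.nonsing_inv_mul _ hPdet]
    have hσ_mul (g h : G) : σ (g * h) = σ g * σ h := by
      simp only [hσ, map_mul]
      rw [show P⁻¹ * ρ g * P * (P⁻¹ * ρ h * P) = P⁻¹ * ρ g * (P * P⁻¹) * ρ h * P by
        simp only [Matrix.mul_assoc], Matrix.mul_nonsing_inv _ hPdet]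
      simp only [Matrix.mul_assoc, Matrix.mul_one]
    -- the quotient representation by the line of the fixed vector
    let τ : G →* Matrix {j // j ≠ i} {j // j ≠ i} (ZMod q) :=
      { toFun := fun g => (σ g).submatrix (↑) (↑)
        map_one' := by
          rw [hσ_one]
          exact Matrix.submatrix_one _ Subtype.val_injective
        map_mul' := fun g h => by
          ext j k
          rw [hσ_mul, Matrix.submatrix_apply, Matrix.mul_apply, Matrix.mul_apply,
            Fintype.sum_eq_add_sum_subtype_ne _ i, hσcol, if_neg j.2, zero_mul, zero_add]
          rfl }
    have hτ : Fintype.card {j // j ≠ i} = n := by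
      have := Fintype.card_subtype_compl (fun j => j = i)
      simp only [Fintype.card_subtype_eq] at this
      rw [this, hι]
      rfl
    have hconj : (∑ g, M g ⊗ₖ (ρ g).map (algebraMap (ZMod q) R)).det =
        (∑ g, M g ⊗ₖ (σ g).map (algebraMap (ZMod q) R)).det := by
      have key : ((1 : Matrix m m R) ⊗ₖ P.map (algebraMap (ZMod q) R)) *
          (∑ g, M g ⊗ₖ (σ g).map (algebraMap (ZMod q) R)) =
          (∑ g, M g ⊗ₖ (ρ g).map (algebraMap (ZMod q) R)) *
          ((1 : Matrix m m R) ⊗ₖ P.map (algebraMap (ZMod q) R)) := by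
        rw [Finset.mul_sum, Finset.sum_mul]
        refine Finset.sum_congr rfl fun g _ => ?_
        rw [← Matrix.mul_kronecker_mul, ← Matrix.mul_kronecker_mul, ← Matrix.map_mul,
          ← Matrix.map_mul, Matrix.one_mul, Matrix.mul_one, hσ]
        simp only
        rw [← Matrix.mul_assoc, ← Matrix.mul_assoc, Matrix.mul_nonsing_inv _ hPdet,
          Matrix.one_mul]
      have hu : IsUnit ((1 : Matrix m m R) ⊗ₖ P.map (algebraMap (ZMod q) R)).det := by
        rw [Matrix.det_kronecker, Matrix.det_one, one_pow, one_mul]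
        refine IsUnit.pow _ ?_
        have := hPdet.map (algebraMap (ZMod q) R)
        rwa [RingHom.map_det] at this
      have := congrArg Matrix.det key
      rw [Matrix.det_mul, Matrix.det_mul, mul_comm] at this
      exact (hu.mul_right_cancel this).symm
    rw [hconj, Matrix.twoBlockTriangular_det _ (fun x : m × ι => x.2 = i)]
    · have hfix : (Matrix.toSquareBlockProp (∑ g, M g ⊗ₖ (σ g).map (algebraMap (ZMod q) R))
          (fun x : m × ι => x.2 = i)).det = (∑ g, M g).det := by
        let e : m ≃ {x : m × ι // x.2 = i} :=
          { toFun := fun a => ⟨(a, i), rfl⟩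
            invFun := fun x => x.1.1
            left_inv := fun _ => rfl
            right_inv := fun x => Subtype.ext (Prod.ext rfl x.2.symm) }
        rw [← Matrix.det_submatrix_equiv_self e]
        congr 1
        ext a b
        simp [Matrix.toSquareBlockProp_def, Matrix.sum_apply, e, hσcol]
      have hquot : (Matrix.toSquareBlockProp (∑ g, M g ⊗ₖ (σ g).map (algebraMap (ZMod q) R))
          (fun x : m × ι => ¬ x.2 = i)).det = (∑ g, M g).det ^ n := by
        rw [← ih hτ τ]
        let e : m × {j // j ≠ i} ≃ {x : m × ι // ¬ x.2 = i} :=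
          { toFun := fun a => ⟨(a.1, a.2.1), a.2.2⟩
            invFun := fun x => (x.1.1, ⟨x.1.2, x.2⟩)
            left_inv := fun _ => rfl
            right_inv := fun _ => rfl }
        rw [← Matrix.det_submatrix_equiv_self e]
        congr 1
        ext a b
        simp [Matrix.toSquareBlockProp_def, Matrix.sum_apply, e, τ]
      rw [hfix, hquot, pow_succ']
    · intro x hx y hy
      simp [Matrix.sum_apply, hy, hσcol, hx]

/-- A matrix invariant under a free action of a finite `q`-group on the index set, over a ring of
characteristic `q`, has the determinant of its matrix of orbit sums raised to the order of the
group. The orbits are the fibres of `π`. -/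
theorem det_eq_pow_of_free_action {q : ℕ} [Fact q.Prime] {G : Type*} [Group G] [Finite G]
    (hG : IsPGroup q G) {R : Type*} [CommRing R] [Algebra (ZMod q) R]
    {V W : Type*} [Fintype V] [DecidableEq V] [Fintype W] [DecidableEq W] [MulAction G W]
    (π : W → V) (hπ : Function.Surjective π)
    (hfree : ∀ (g : G) (w : W), g • w = w → g = 1)
    (horb : ∀ w w' : W, π w = π w' ↔ ∃ g : G, g • w = w')
    (M : Matrix W W R) (hM : ∀ (g : G) (w w' : W), M (g • w) (g • w') = M w w')
    (N : Matrix V V R) (hN : ∀ w v, ∑ w', (if π w' = v then M w w' else 0) = N (π w) v) :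
    M.det = N.det ^ Nat.card G := by
  classical
  let _ := Fintype.ofFinite G
  set s := Function.surjInv hπ with hs
  have hπs (v : V) : π (s v) = v := Function.surjInv_eq hπ v
  have hπg (g : G) (w : W) : π (g • w) = π w := ((horb w (g • w)).mpr ⟨g, rfl⟩).symm
  have hbij : Function.Bijective (fun x : V × G => x.2 • s x.1) := by
    constructor
    · rintro ⟨v, g⟩ ⟨v', g'⟩ h
      simp only at h
      have hv : v = v' := by
        rw [← hπs v, ← hπg g, h, hπg, hπs]
      subst hv
      have : (g'⁻¹ * g) • s v = s v := by rw [mul_smul, h, inv_smul_smul]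
      rw [inv_mul_eq_one.mp (hfree _ _ this)]
    · intro w
      obtain ⟨g, hg⟩ := (horb (s (π w)) w).mp (hπs _)
      exact ⟨(π w, g), hg⟩
  let e : V × G ≃ W := Equiv.ofBijective _ hbij
  have he (v : V) (g : G) : e (v, g) = g • s v := rfl
  -- the regular representation, by right translations, which commute with the left action of `G`
  let ρ : G →* Matrix G G (ZMod q) :=
    { toFun := fun k => Matrix.of fun g h => if g * k = h then 1 else 0
      map_one' := by
        ext g h
        simp [Matrix.one_apply]
      map_mul' := fun k k' => by
        ext g h
        simp only [Matrix.mul_apply, Matrix.of_apply]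
        rw [Fintype.sum_eq_single (g * k) (fun x hx => by simp [hx.symm])]
        simp [mul_assoc] }
  have hdet := det_sum_kronecker_of_isPGroup hG
    (fun k : G => Matrix.of fun v v' => M (s v) (k • s v')) (Nat.card G)
    (Nat.card_eq_fintype_card).symm ρ
  have hsum : (∑ k : G, Matrix.of fun v v' => M (s v) (k • s v')) = N := by
    ext v v'
    have h1 := hN (s v) v'
    rw [hπs, ← Equiv.sum_comp e, Fintype.sum_prod_type] at h1
    rw [← h1, Matrix.sum_apply]
    simp [he, hπg, hπs]
  rw [hsum] at hdet
  rw [← hdet, ← Matrix.det_submatrix_equiv_self e]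
  congr 1
  ext ⟨v, g⟩ ⟨v', h⟩
  have h2 : M (g • s v) (h • s v') = M (s v) ((g⁻¹ * h) • s v') := by
    rw [← hM g⁻¹, inv_smul_smul, mul_smul]
  have h3 (k : G) : g * k = h ↔ g⁻¹ * h = k := by
    rw [inv_mul_eq_iff_eq_mul, eq_comm]
  simp [Matrix.sum_apply, ρ, he, h2, h3]

namespace SerreGraph

/-! ### Invariants of power series and reduction modulo `ℓ` -/

section Series

variable {ℓ : ℕ} [Fact ℓ.Prime]

theorem emultiplicity_eq_zero_iff_toZMod_ne_zero (a : ℤ_[ℓ]) :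
    emultiplicity (ℓ : ℤ_[ℓ]) a = 0 ↔ PadicInt.toZMod a ≠ 0 := by
  rw [emultiplicity_eq_zero, ne_eq, ← RingHom.mem_ker, PadicInt.ker_toZMod,
    PadicInt.maximalIdeal_eq_span_p, Ideal.mem_span_singleton]

theorem seriesMu_eq_zero_iff (Q : PowerSeries ℤ_[ℓ]) :
    seriesMu Q = 0 ↔ PowerSeries.map PadicInt.toZMod Q ≠ 0 := by
  rw [seriesMu, ENat.iInf_eq_zero]
  simp only [emultiplicity_eq_zero_iff_toZMod_ne_zero]
  rw [ne_eq, PowerSeries.ext_iff, not_forall]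
  simp

theorem seriesLambda_eq_order {Q : PowerSeries ℤ_[ℓ]} (h : seriesMu Q = 0) :
    (seriesLambda Q : ℕ∞) = (PowerSeries.map PadicInt.toZMod Q).order := by
  have hne : {i : ℕ | PadicInt.toZMod (PowerSeries.coeff i Q) ≠ 0}.Nonempty := by
    by_contra hcon
    apply (seriesMu_eq_zero_iff Q).mp h
    ext i
    by_contra hi
    exact hcon ⟨i, by simpa using hi⟩
  simp only [seriesLambda, h, emultiplicity_eq_zero_iff_toZMod_ne_zero]
  symm
  rw [PowerSeries.order_eq_nat]
  refine ⟨by simpa using Nat.sInf_mem hne, fun i hi => ?_⟩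
  simpa using Nat.notMem_of_lt_sInf hi

end Series

/-! ### The characteristic matrix of a cover -/

section Cover

variable {V E W F : Type*} {X : SerreGraph V E} {Y : SerreGraph W F}

theorem extend_pullVoltage {A : Type*} [AddGroup A] (p : Hom Y X) (S : X.Orientation)
    (α : S.carrier → A) (e : F) :
    extend (S.comap p) (p.pullVoltage S α) e = extend S α (p.onE e) := by
  by_cases h : p.onE e ∈ S.carrier
  · have h' : e ∈ (S.comap p).carrier := h
    simp [extend, h, h', Hom.pullVoltage]
  · have h' : e ∉ (S.comap p).carrier := h
    simp [extend, h, h', Hom.pullVoltage, p.map_inv]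

theorem derived_connected_of_comap {A : Type*} [AddGroup A] (p : Hom Y X)
    (hp : Function.Surjective p.onV) (S : X.Orientation) (α : S.carrier → A)
    (h : (derived (S.comap p) (p.pullVoltage S α)).Connected) :
    (derived S α).Connected := by
  obtain ⟨⟨w⟩, hpath⟩ := h
  refine ⟨⟨(p.onV w.1, w.2)⟩, ?_⟩
  rintro ⟨v, a⟩ ⟨v', a'⟩
  obtain ⟨w, rfl⟩ := hp v
  obtain ⟨w', rfl⟩ := hp v'
  refine (hpath (w, a) (w', a')).lift (fun x => (p.onV x.1, x.2)) ?_
  rintro _ _ ⟨⟨e, b⟩, rfl, rfl⟩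
  exact ⟨(p.onE e, b), by simp [derived, p.map_o], by
    simp [derived, p.map_t, extend_pullVoltage]⟩

open Classical in
/-- The characteristic matrix as a sum over all directed edges, free of the orientation. -/
theorem charMatrix_apply {ℓ : ℕ} [Fact ℓ.Prime] [Fintype E] (S : X.Orientation)
    (α : S.carrier → ℤ_[ℓ]) (i j : V) :
    charMatrix S α i j = (if i = j then (Nat.card {e : E // X.o e = i} : PowerSeries ℤ_[ℓ]) else 0)
      - ∑ e, if X.o e = i ∧ X.t e = j then
          PowerSeries.binomialSeries ℤ_[ℓ] (extend S α e) else 0 := by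
  -- the edges are the elements of `S` and their inverses
  have hbij : Function.Bijective
      (Sum.elim (fun s => s.1) (fun s => X.inv s.1) : S.carrier ⊕ S.carrier → E) := by
    constructor
    · rintro (⟨a, ha⟩ | ⟨a, ha⟩) (⟨b, hb⟩ | ⟨b, hb⟩) h <;>
        simp only [Sum.elim_inl, Sum.elim_inr] at h
      · subst h; rfl
      · subst h; exact absurd ha (S.disj b hb)
      · subst h; exact absurd hb (S.disj a ha)
      · have : a = b := by rw [← X.inv_inv a, h, X.inv_inv]
        subst this; rfl
    · intro e
      rcases S.cover e with h | h
      · exact ⟨Sum.inl ⟨e, h⟩, rfl⟩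
      · exact ⟨Sum.inr ⟨_, h⟩, X.inv_inv e⟩
  rw [← hbij.sum_comp, Fintype.sum_sum_type, charMatrix, Matrix.sub_apply, Matrix.diagonal_apply,
    Matrix.of_apply]
  congr 2
  · refine Finset.sum_congr rfl fun s _ => ?_
    simp [extend]
  · refine Finset.sum_congr rfl fun s _ => ?_
    simp [extend_inv, X.o_inv, X.t_inv, and_comm]
    simp [extend]

theorem card_edges_from_eq {p : Hom Y X} (hp : p.IsCover) (w : W) :
    Nat.card {e : F // Y.o e = w} = Nat.card {e : E // X.o e = p.onV w} :=
  Nat.card_congr (hp.2 w).equiv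

open Classical in
/-- Summing the characteristic matrix of a cover over a fibre gives the one of the base. -/
theorem sum_fibre_charMatrix {ℓ : ℕ} [Fact ℓ.Prime] [Fintype E] [Fintype W] [Fintype F]
    {p : Hom Y X} (hp : p.IsCover) (S : X.Orientation) (α : S.carrier → ℤ_[ℓ]) (w : W) (v : V) :
    ∑ w', (if p.onV w' = v then charMatrix (S.comap p) (p.pullVoltage S α) w w' else 0) =
      charMatrix S α (p.onV w) v := by
  have hdiag : ∑ w', (if p.onV w' = v then
      if w = w' then (Nat.card {e : F // Y.o e = w} : PowerSeries ℤ_[ℓ]) else 0 else 0) =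
      if p.onV w = v then (Nat.card {e : E // X.o e = p.onV w} : PowerSeries ℤ_[ℓ]) else 0 := by
    rw [Fintype.sum_eq_single w (fun w' h => by simp [h.symm]), card_edges_from_eq hp]
    simp
  have hadj : ∑ w', (if p.onV w' = v then ∑ e, (if Y.o e = w ∧ Y.t e = w' then
        PowerSeries.binomialSeries ℤ_[ℓ] (extend S α (p.onE e)) else 0) else 0) =
      ∑ e, if X.o e = p.onV w ∧ X.t e = v then
        PowerSeries.binomialSeries ℤ_[ℓ] (extend S α e) else 0 := by
    calc _ = ∑ e, if Y.o e = w ∧ p.onV (Y.t e) = v then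
          PowerSeries.binomialSeries ℤ_[ℓ] (extend S α (p.onE e)) else 0 := by
          rw [show (∑ w', if p.onV w' = v then ∑ e, (if Y.o e = w ∧ Y.t e = w' then
            PowerSeries.binomialSeries ℤ_[ℓ] (extend S α (p.onE e)) else 0) else 0) =
            ∑ w', ∑ e, if p.onV w' = v then (if Y.o e = w ∧ Y.t e = w' then
            PowerSeries.binomialSeries ℤ_[ℓ] (extend S α (p.onE e)) else 0) else 0 from
            Finset.sum_congr rfl fun w' _ => by split_ifs <;> simp, Finset.sum_comm]
          refine Finset.sum_congr rfl fun e _ => ?_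
          rw [Fintype.sum_eq_single (Y.t e) (fun w' h => by simp [h.symm])]
          split_ifs <;> simp_all
      _ = _ := by
          rw [← Finset.sum_filter, ← Finset.sum_filter]
          refine Finset.sum_bij (fun e _ => p.onE e) ?_ ?_ ?_ (fun _ _ => rfl)
          · intro e he
            simp only [Finset.mem_filter, Finset.mem_univ, true_and] at he ⊢
            exact ⟨(hp.2 w).1 he.1, by rw [← p.map_t, he.2]⟩
          · intro e he e' he' h
            simp only [Finset.mem_filter, Finset.mem_univ, true_and] at he he'
            exact (hp.2 w).2.1 he.1 he'.1 h
          · intro f hf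
            simp only [Finset.mem_filter, Finset.mem_univ, true_and] at hf
            obtain ⟨e, he, rfl⟩ := (hp.2 w).2.2 hf.1
            refine ⟨e, ?_, rfl⟩
            simp only [Finset.mem_filter, Finset.mem_univ, true_and]
            exact ⟨he, by rw [p.map_t, hf.2]⟩
  rw [charMatrix_apply, ← hdiag, ← hadj, ← Finset.sum_sub_distrib]
  refine Finset.sum_congr rfl fun w' _ => ?_
  simp only [charMatrix_apply, extend_pullVoltage]
  split_ifs <;> simp

theorem charMatrix_deckGroup {ℓ : ℕ} [Fact ℓ.Prime] [Fintype F] {p : Hom Y X}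
    (S : X.Orientation) (α : S.carrier → ℤ_[ℓ]) {σ : Equiv.Perm W × Equiv.Perm F}
    (hσ : σ ∈ p.deckGroup) (w w' : W) :
    charMatrix (S.comap p) (p.pullVoltage S α) (σ.1 w) (σ.1 w') =
      charMatrix (S.comap p) (p.pullVoltage S α) w w' := by
  classical
  obtain ⟨ho, ht, -, -, hE⟩ := hσ
  have hcard : Nat.card {e : F // Y.o e = σ.1 w} = Nat.card {e : F // Y.o e = w} :=
    (Nat.card_congr (σ.2.subtypeEquiv fun e => by
      rw [← ho, σ.1.injective.eq_iff])).symm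
  rw [charMatrix_apply, charMatrix_apply, hcard, ← Equiv.sum_comp σ.2]
  simp only [extend_pullVoltage, hE, ← ho, ← ht, σ.1.injective.eq_iff]

/-! ### The Galois group -/

/-- The action of the group of deck transformations on the vertices. -/
abbrev deckAction (p : Hom Y X) : MulAction p.deckGroup W :=
  MulAction.compHom W ((MonoidHom.fst (Equiv.Perm W) (Equiv.Perm F)).comp p.deckGroup.subtype)

/-- A deck transformation of a connected cover is determined by the image of one vertex. -/
theorem eq_one_of_mem_deckGroup {p : Hom Y X} (hp : p.IsCover) (hY : Y.Connected)
    {σ : Equiv.Perm W × Equiv.Perm F} (hσ : σ ∈ p.deckGroup) {w : W} (hw : σ.1 w = w) :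
    σ = 1 := by
  obtain ⟨ho, ht, -, -, hE⟩ := hσ
  have hedge (e : F) (he : σ.1 (Y.o e) = Y.o e) : σ.2 e = e :=
    (hp.2 (Y.o e)).2.1 ((ho e).symm.trans he) rfl (hE e)
  have hvert (w' : W) : σ.1 w' = w' := by
    induction hY.2 w w' with
    | refl => exact hw
    | tail _ h ih =>
      obtain ⟨e, rfl, rfl⟩ := h
      rw [ht, hedge e ih]
  exact Prod.ext (Equiv.ext hvert) (Equiv.ext fun e => hedge e (hvert _))

theorem hasDegree_card_deckGroup {p : Hom Y X} (hp : p.IsGalois) :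
    p.HasDegree (Nat.card p.deckGroup) := by
  obtain ⟨hcov, hY, htrans⟩ := hp
  intro v
  obtain ⟨w, rfl⟩ := hcov.1 v
  refine (Nat.card_congr (Equiv.ofBijective (fun σ : p.deckGroup =>
    (⟨σ.1.1 w, σ.2.2.2.2.1 w⟩ : {w' : W // p.onV w' = p.onV w})) ⟨?_, ?_⟩)).symm
  · intro σ τ h
    have h' : σ.1.1 w = τ.1.1 w := congrArg Subtype.val h
    have : ((τ⁻¹ * σ : p.deckGroup) : Equiv.Perm W × Equiv.Perm F) = 1 :=
      eq_one_of_mem_deckGroup hcov hY (τ⁻¹ * σ).2 (w := w) (by simp [h'])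
    exact (inv_mul_eq_one.mp (Subtype.ext this)).symm
  · rintro ⟨w', hw'⟩
    obtain ⟨σ, hσ, h⟩ := htrans w w' hw'.symm
    exact ⟨⟨σ, hσ⟩, Subtype.ext h⟩

/-- Modulo `ℓ`, the characteristic series of a Galois cover with group an `ℓ`-group is a power of
the characteristic series of the base. -/
theorem map_charSeries_comap {ℓ : ℕ} [Fact ℓ.Prime] [Fintype V] [Fintype E] [Fintype W]
    [Fintype F] {p : Hom Y X} (hp : p.IsGalois) (hG : IsPGroup ℓ p.deckGroup)
    (S : X.Orientation) (α : S.carrier → ℤ_[ℓ]) :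
    PowerSeries.map PadicInt.toZMod (charSeries (S.comap p) (p.pullVoltage S α)) =
      PowerSeries.map PadicInt.toZMod (charSeries S α) ^ Nat.card p.deckGroup := by
  classical
  let _ := deckAction p
  rw [charSeries, charSeries, RingHom.map_det, RingHom.map_det]
  refine det_eq_pow_of_free_action hG p.onV hp.1.1 (fun σ w h => Subtype.ext
    (eq_one_of_mem_deckGroup hp.1 hp.2.1 σ.2 h)) (fun w w' => ⟨fun h => ?_, ?_⟩) _
    (fun σ w w' => ?_) _ (fun w v => ?_)
  · obtain ⟨σ, hσ, h⟩ := hp.2.2 w w' h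
    exact ⟨⟨σ, hσ⟩, h⟩
  · rintro ⟨σ, rfl⟩
    exact (σ.2.2.2.2.1 w).symm
  · exact congrArg (PowerSeries.map PadicInt.toZMod) (charMatrix_deckGroup S α σ.2 w w')
  · have := congrArg (PowerSeries.map (PadicInt.toZMod (p := ℓ)))
      (sum_fibre_charMatrix hp.1 S α w v)
    rw [map_sum] at this
    simpa [apply_ite (PowerSeries.map (PadicInt.toZMod (p := ℓ)))] using this

end Cover

end SerreGraph

theorem theorem4p1 {V E W F : Type*} [Fintype V] [Fintype E] [Fintype W] [Fintype F]
    (ℓ : ℕ) [Fact ℓ.Prime]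
    (X : SerreGraph V E) (hX : X.Connected) (hχ : X.eulerChar ≠ 0)
    (S : X.Orientation) (α : S.carrier → ℤ_[ℓ])
    (Y : SerreGraph W F) (p : SerreGraph.Hom Y X) (hp : p.IsGalois)
    (hG : IsPGroup ℓ p.deckGroup)
    (hα : SerreGraph.TowerConnected (S.comap p) (p.pullVoltage S α)) :
    SerreGraph.TowerConnected S α ∧
    ∃ d : ℕ, p.HasDegree d ∧
      (SerreGraph.iwasawaMu S α = 0 ↔
        SerreGraph.iwasawaMu (S.comap p) (p.pullVoltage S α) = 0) ∧
      (SerreGraph.iwasawaMu S α = 0 →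
        SerreGraph.iwasawaLambda (S.comap p) (p.pullVoltage S α) + 1 =
          (d : ℤ) * (SerreGraph.iwasawaLambda S α + 1)) := by
  have hpow := SerreGraph.map_charSeries_comap hp hG S α
  have hcard : Nat.card p.deckGroup ≠ 0 := Nat.card_pos.ne'
  have hμ : SerreGraph.iwasawaMu S α = 0 ↔
      SerreGraph.iwasawaMu (S.comap p) (p.pullVoltage S α) = 0 := by
    rw [SerreGraph.iwasawaMu, SerreGraph.iwasawaMu, SerreGraph.seriesMu_eq_zero_iff,
      SerreGraph.seriesMu_eq_zero_iff, hpow, ne_eq, ne_eq, pow_eq_zero_iff hcard]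
  refine ⟨fun n => SerreGraph.derived_connected_of_comap p hp.1.1 S _ (hα n), _,
    SerreGraph.hasDegree_card_deckGroup hp, hμ, fun h => ?_⟩
  have hlam : SerreGraph.seriesLambda (SerreGraph.charSeries (S.comap p) (p.pullVoltage S α)) =
      Nat.card p.deckGroup * SerreGraph.seriesLambda (SerreGraph.charSeries S α) := by
    have hY := SerreGraph.seriesLambda_eq_order (hμ.mp h)
    rw [hpow, PowerSeries.order_pow, ← SerreGraph.seriesLambda_eq_order h, nsmul_eq_mul] at hY
    exact_mod_cast hY
  simp only [SerreGraph.iwasawaLambda, hlam]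
  push_cast
  ring
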